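/- Let $N\ge 1$, $q\ge 0$. For $i=1,\dots,N$ consider agents $$\dot x_i=A_ix_i+B_iu_i,\qquad y_i=C_ix_i,\qquad x_i\in\mathbb R^{n_i},\ u_i\in\mathbb R^{p_i},\ y_i\in\mathbb R^q,$$ with constant real matrices $A_i,B_i,C_i$ and local cost functions $f_i:\mathbb R^q\to\mathbb R$, and the problem $$\min\ \sum_{i=1}^N f_i(y_i)\quad\text{s.t.}\quad y_1=\dots=y_N.\tag{P}$$ Assume: 1. The communication graph is undirected and connected, with symmetric weights $a_{ij}=a_{ji}$, $a_{ij}>0$ if $\{i,j\}$ is an edge and $a_{ij}=0$ otherwise. Let $L=\mathrm{diag}\big(\sum_j a_{ji}\big)_i-(a_{ij})$ be its Laplacian and $\lambda_N$ the largest eigenvalue of $L$. 2. Each $f_i$ is differentiable and $\|\nabla f_i(x)-\nabla f_i(y)\|\le w_i\|x-y\|$ for all $x,y\in\mathbb R^q$, with $w_i>0$. Let $\overline w=\max_i w_i$. 3. $(x-y)^\top(\nabla f_i(x)-\nabla f_i(y))\ge m_i\|x-y\|^2$ for all $x,y\in\mathbb R^q$, with $m_i>0$. Let $\underline m=\min_i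 m_i$. 4. Each pair $(A_i,B_i)$ is controllable, and $\mathrm{rank}(C_iB_i)=q$. Let $K_{\alpha_i},K_{\beta_i}$ be any solutions of $C_iB_iK_{\alpha_i}=C_iA_i$ and $C_iB_iK_{\beta_i}=I_q$. Let $\xi>\frac{4\overline w^2+2\lambda_N^2+1}{8\underline m}$, $\epsilon=\frac{1}{2\sqrt{2(\xi^2+(\xi-1)^2)}}$ and $$\tau_0=\frac{1}{\overline w+1}\ln\left(1+\frac{(\overline w+1)\epsilon}{\overline w+1+\sqrt2\lambda_N+\sqrt2\lambda_N\epsilon}\right).$$ Then (P) has a unique solution $y_1=\dots=y_N=y^*$, and there is a rate $c>0$ such that the following holds for every $\Delta\in(0,\tau_0]$. Let all agents communicate at the instants $t_0=0$, $t_{k+1}=t_k+\Delta$, put $\hat y_i(t)=y_i(t_k)$ for $t\in[t_k,t_{k+1})$, and apply the protocol $$u_i=-K_{\alpha_i}x_i+K_{\beta_i}\Big(-\nabla f_i(y_i)-\sum_{j=1}^N a_{ij}(\hat y_i-\hat y_j)-\eta_i\Big),\qquad \dot\eta_i=\sum_{j=1}^N a_{ij}(\hat y_i-\hat y_j),\quad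 \eta_i(0)=0.$$ Then for every solution of the closed-loop system on $[0,\infty)$ (with any initial states $x_i(0)$; continuous $x_i,\eta_i$, with the differential equations holding for right derivatives) there is a constant $M$ such that $\|y_i(t)-y^*\|\le M e^{-ct}$ for all $t\ge 0$ and all $i$; that is, every output converges to $y^*$ exponentially. -/

import Mathlib

noncomputable section

namespace OptimalOutput

/-- A weighted undirected communication graph on `N` nodes: `a i j` is the weight of the edge
between `i` and `j`, positive exactly on the edges. -/
structure CommGraph (N : ℕ) where
  graph : SimpleGraph (Fin N)
  a : Matrix (Fin N) (Fin N) ℝ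
  symm : ∀ i j, a i j = a j i
  pos_of_adj : ∀ i j, graph.Adj i j → 0 < a i j
  zero_of_not_adj : ∀ i j, ¬ graph.Adj i j → a i j = 0

/-- The Laplacian `D^out - A`, with `D^out` the diagonal matrix of the `d_i = ∑ j, a j i`. -/
def CommGraph.laplacian {N : ℕ} (G : CommGraph N) : Matrix (Fin N) (Fin N) ℝ :=
  Matrix.diagonal (fun i => ∑ j, G.a j i) - G.a

/-- The largest eigenvalue `λ_N` of the (real symmetric) Laplacian. -/
def CommGraph.lambdaMax {N : ℕ} (G : CommGraph N) : ℝ :=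
  sSup (spectrum ℝ G.laplacian)

/-- The data of `N` heterogeneous linear agents `ẋ_i = A_i x_i + B_i u_i`, `y_i = C_i x_i`
with outputs in `ℝ^q`, and of their local cost functions `f_i`. -/
structure MultiAgent (N q : ℕ) where
  n : Fin N → ℕ
  p : Fin N → ℕ
  A : ∀ i, Matrix (Fin (n i)) (Fin (n i)) ℝ
  B : ∀ i, Matrix (Fin (n i)) (Fin (p i)) ℝ
  C : ∀ i, Matrix (Fin q) (Fin (n i)) ℝ
  f : Fin N → EuclideanSpace ℝ (Fin q) → ℝ

/-- The controllability matrix `(B, AB, …, A^{n-1}B)`; its columns are indexed by pairs `(k, c)`,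
for column `c` of the block `A^k B`. -/
def controllabilityMatrix {n p : ℕ} (A : Matrix (Fin n) (Fin n) ℝ)
    (B : Matrix (Fin n) (Fin p) ℝ) : Matrix (Fin n) (Fin n × Fin p) ℝ :=
  Matrix.of fun r kc => (A ^ (kc.1 : ℕ) * B) r kc.2

/-- Controllability of the pair `(A, B)` (Kalman). -/
def Controllable {n p : ℕ} (A : Matrix (Fin n) (Fin n) ℝ)
    (B : Matrix (Fin n) (Fin p) ℝ) : Prop :=
  (controllabilityMatrix A B).rank = n

/-- Each `f_i` is differentiable with `w_i`-Lipschitz gradient, `w_i > 0`. -/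
structure MultiAgent.SmoothCosts {N q : ℕ} (S : MultiAgent N q) (w : Fin N → ℝ) : Prop where
  pos : ∀ i, 0 < w i
  differentiable : ∀ i, Differentiable ℝ (S.f i)
  lipschitz : ∀ i x y, ‖gradient (S.f i) x - gradient (S.f i) y‖ ≤ w i * ‖x - y‖

/-- Each `f_i` is `m_i`-strongly convex, `m_i > 0`. -/
structure MultiAgent.StronglyConvexCosts {N q : ℕ} (S : MultiAgent N q) (m : Fin N → ℝ) :
    Prop where
  pos : ∀ i, 0 < m i
  strong : ∀ i x y,
    m i * ‖x - y‖ ^ 2 ≤ inner ℝ (x - y) (gradient (S.f i) x - gradient (S.f i) y)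

/-- Each `(A_i, B_i)` is controllable and `rank (C_i B_i) = q`. -/
structure MultiAgent.RankCondition {N q : ℕ} (S : MultiAgent N q) : Prop where
  controllable : ∀ i, Controllable (S.A i) (S.B i)
  rank_eq : ∀ i, (S.C i * S.B i).rank = q

/-- `z` is the common value of a solution of `min ∑ f_i(y_i)` subject to `y_1 = ⋯ = y_N`. -/
def MultiAgent.IsOptimal {N q : ℕ} (S : MultiAgent N q) (z : EuclideanSpace ℝ (Fin q)) : Prop :=
  IsMinOn (fun y : Fin N → EuclideanSpace ℝ (Fin q) => ∑ i, S.f i (y i))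
    {y | ∀ i j, y i = y j} (fun _ => z)

/-- The signals `x, u, y, yhat, η` form, on `[0, ∞)`, a trajectory of the agents under the
sampled-output protocol with feedback matrices `Kα i`, `Kβ i` and with the communication instants
`tk i 0, tk i 1, …` of agent `i`.
Because `yhat` jumps at communication instants, the states are continuous and the differential
equations hold for the right derivative (hence for the derivative between instants). -/
structure MultiAgent.IsTrajectory {N q : ℕ} (S : MultiAgent N q) (G : CommGraph N)
    (Kα : ∀ i, Matrix (Fin (S.p i)) (Fin (S.n i)) ℝ)
    (Kβ : ∀ i, Matrix (Fin (S.p i)) (Fin q) ℝ)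
    (tk : Fin N → ℕ → ℝ)
    (x : ∀ i, ℝ → EuclideanSpace ℝ (Fin (S.n i)))
    (u : ∀ i, ℝ → EuclideanSpace ℝ (Fin (S.p i)))
    (y yhat η : Fin N → ℝ → EuclideanSpace ℝ (Fin q)) : Prop where
  output : ∀ i, ∀ t, 0 ≤ t → y i t = Matrix.toEuclideanLin (S.C i) (x i t)
  hold : ∀ i k, ∀ t ∈ Set.Ico (tk i k) (tk i (k + 1)), yhat i t = y i (tk i k)
  input : ∀ i, ∀ t, 0 ≤ t →
    u i t = - Matrix.toEuclideanLin (Kα i) (x i t)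
      + Matrix.toEuclideanLin (Kβ i)
          (- gradient (S.f i) (y i t) - ∑ j, G.a i j • (yhat i t - yhat j t) - η i t)
  state_continuous : ∀ i, ContinuousOn (x i) (Set.Ici 0)
  state_deriv : ∀ i, ∀ t, 0 ≤ t →
    HasDerivWithinAt (x i)
      (Matrix.toEuclideanLin (S.A i) (x i t) + Matrix.toEuclideanLin (S.B i) (u i t))
      (Set.Ici t) t
  integral_zero : ∀ i, η i 0 = 0
  integral_continuous : ∀ i, ContinuousOn (η i) (Set.Ici 0)
  integral_deriv : ∀ i, ∀ t, 0 ≤ t →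
    HasDerivWithinAt (η i) (∑ j, G.a i j • (yhat i t - yhat j t)) (Set.Ici t) t

/-- `ε = 1 / (2 √(2 (ξ² + (ξ - 1)²)))`. -/
def epsilon (ξ : ℝ) : ℝ := 1 / (2 * √(2 * (ξ ^ 2 + (ξ - 1) ^ 2)))

/-- The bound `τ_0` on the communication period, as a function of `w̄`, `λ_N` and `ξ`. -/
def tau0 (wbar lam ξ : ℝ) : ℝ :=
  1 / (wbar + 1) *
    Real.log (1 + (wbar + 1) * epsilon ξ / (wbar + 1 + √2 * lam + √2 * lam * epsilon ξ))

end OptimalOutput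

end

/-! The feedback matrices cancel the drift, so the outputs obey `ẏ_i = -∇f_i(y_i) - (Lŷ)_i - η_i`.
The sum of the gradients is a strongly monotone Lipschitz gradient, so it has a zero `y*`, which is
the unique optimum. Put `z = y - y*` and `ζ_i = η_i + ∇f_i(y*)`. With `H` the recentred stacked
gradient and `L` the Laplacian on stacked outputs, `ż = -H z - L ẑ - ζ`, `ζ̇ = L ẑ`. On a connected
graph the kernel of `L` is the consensus space. Hence `ζ` starts orthogonal to it, because the
gradients at `y*` sum to zero, and it stays so, because `ζ̇` lies in the range of `L`.

The Lyapunov function is `V = (θ-1)/2 ‖z‖² + 1/2 ‖z+ζ‖² + θ/2 ⟨ζ, Pζ⟩`, where `P` inverts `L` on the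
complement of its kernel. In `z + ζ` the coupling `L ẑ` cancels, and `P` turns `L ẑ` back into `ẑ`.
With `e = ẑ - z`, the derivative (`lyapunov_deriv_eq`) contains good terms in `‖z‖²` and `‖ζ‖²`, and
cross terms in `e`.

The bound `Δ ≤ τ₀` gives `‖e‖ ≤ ε ‖(z, ζ)‖` at the current time, by a Grönwall estimate run
backwards from that time to the last sample (`sampling_error_le`). The value of `ε` and the lower
bound on `ξ` are what Young's inequality needs to make `V' ≤ -δ(‖z‖² + ‖ζ‖²)`
(`exists_lyapunov_parameters`). Since `V` is bounded above by a multiple of `‖z‖² + ‖ζ‖²` and below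
by a multiple of `‖z‖²`, decay follows. No constant in the rate involves `Δ` or the initial state.
-/

noncomputable section

namespace OptimalOutput

open Set Filter Topology

/-! ### Calculus with right derivatives: Grönwall and comparison estimates. -/

section RightDerivative

variable {F : Type*} [NormedAddCommGroup F] [NormedSpace ℝ F]

/-- A function with continuous right derivative on `[a, b)` is differentiable on `(a, b)`. -/
theorem hasDerivAt_of_continuousOn_deriv_right [CompleteSpace F] {X X' : ℝ → F} {a b : ℝ}
    (hX : ContinuousOn X (Ico a b))
    (hd : ∀ s ∈ Ico a b, HasDerivWithinAt X (X' s) (Ici s) s)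
    (hX' : ContinuousOn X' (Ico a b)) {s : ℝ} (hs : s ∈ Ioo a b) :
    HasDerivAt X (X' s) s := by
  have hint : ∀ r ∈ Ico a b, IntervalIntegrable X' MeasureTheory.volume a r := by
    intro r hr
    refine (hX'.mono ?_).intervalIntegrable
    rw [uIcc_of_le hr.1]
    exact fun x hx => ⟨hx.1, hx.2.trans_lt hr.2⟩
  have hFTC : ∀ r ∈ Ico a b, ∫ x in a..r, X' x = X r - X a := by
    intro r hr
    refine intervalIntegral.integral_eq_sub_of_hasDeriv_right (hX.mono ?_) ?_ (hint r hr)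
    · rw [uIcc_of_le hr.1]
      exact fun x hx => ⟨hx.1, hx.2.trans_lt hr.2⟩
    · rw [min_eq_left hr.1, max_eq_right hr.1]
      exact fun x hx => (hd x ⟨hx.1.le, hx.2.trans hr.2⟩).mono Ioi_subset_Ici_self
  have hnhds : Ioo a b ∈ 𝓝 s := Ioo_mem_nhds hs.1 hs.2
  have hcont : ContinuousOn X' (Ioo a b) := hX'.mono Ioo_subset_Ico_self
  have h1 : HasDerivAt (fun r => ∫ x in a..r, X' x) (X' s) s :=
    intervalIntegral.integral_hasDerivAt_right (hint s ⟨hs.1.le, hs.2⟩)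
      (hcont.stronglyMeasurableAtFilter isOpen_Ioo s hs) (hcont.continuousAt hnhds)
  refine (h1.const_add (X a)).congr_of_eventuallyEq ?_
  filter_upwards [hnhds] with r hr
  rw [hFTC r ⟨hr.1.le, hr.2⟩]
  abel

/-- Grönwall's inequality run backwards from the right end point `t`. -/
theorem norm_sub_le_of_norm_deriv_right_le [CompleteSpace F] {X X' : ℝ → F} {a b t K C : ℝ}
    (hK : 0 < K) (ht : t ∈ Ico a b) (hX : ContinuousOn X (Ico a b))
    (hd : ∀ s ∈ Ico a b, HasDerivWithinAt X (X' s) (Ici s) s)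
    (hX' : ContinuousOn X' (Ico a b))
    (hbound : ∀ s ∈ Ico a b, ‖X' s‖ ≤ K * ‖X s‖ + C) :
    ‖X a - X t‖ ≤ (K * ‖X t‖ + C) / K * (Real.exp (K * (t - a)) - 1) := by
  have hmaps : ∀ r ∈ Icc 0 (t - a), t - r ∈ Ico a b := fun r hr =>
    ⟨by linarith [hr.2], by linarith [hr.1, ht.2]⟩
  -- The reversed increment `r ↦ X (t - r) - X t` starts at zero, which gives `δ = 0`. The triangle
  -- inequality moves `K * ‖X t‖` into the constant term.
  have hmain := norm_le_gronwallBound_of_norm_deriv_right_le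
    (f := fun r => X (t - r) - X t) (f' := fun r => -X' (t - r)) (δ := 0) (K := K)
    (ε := K * ‖X t‖ + C) (a := 0) (b := t - a) ?_ ?_ (by simp) ?_ (t - a)
    ⟨by linarith [ht.1], le_rfl⟩
  · rw [gronwallBound_of_K_ne_0 hK.ne'] at hmain
    simpa using hmain
  · refine ContinuousOn.sub ?_ continuousOn_const
    exact hX.comp (by fun_prop) hmaps
  · intro r hr
    -- Reversing time turns right derivatives into left ones, so the two-sided derivative is needed
    -- here; it exists because `X'` is continuous between samples.
    have hmem : t - r ∈ Ioo a b := ⟨by linarith [hr.2], by linarith [hr.1, ht.2]⟩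
    have h1 := hasDerivAt_of_continuousOn_deriv_right hX hd hX' hmem
    have h2 : HasDerivAt (fun r : ℝ => t - r) (-1) r := by
      simpa using (hasDerivAt_id r).const_sub t
    have h3 := (h1.scomp r h2).sub_const (X t)
    simpa using h3.hasDerivWithinAt
  · intro r hr
    have h1 := hbound _ (hmaps r ⟨hr.1, hr.2.le⟩)
    have h2 : ‖X (t - r)‖ ≤ ‖X (t - r) - X t‖ + ‖X t‖ := norm_le_norm_sub_add _ _
    rw [norm_neg]
    nlinarith [mul_le_mul_of_nonneg_left h2 hK.le]

/-- Exponential decay from a differential inequality for the right derivative. -/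
theorem le_mul_exp_of_deriv_right_le {V V' : ℝ → ℝ} {r : ℝ} (hV : ContinuousOn V (Ici 0))
    (hd : ∀ t, 0 ≤ t → HasDerivWithinAt V (V' t) (Ici t) t)
    (hle : ∀ t, 0 ≤ t → V' t ≤ -r * V t) {t : ℝ} (ht : 0 ≤ t) :
    V t ≤ V 0 * Real.exp (-r * t) := by
  have hexp : ∀ s : ℝ, HasDerivAt (fun s => Real.exp (r * s)) (Real.exp (r * s) * r) s := by
    intro s
    simpa using ((hasDerivAt_id s).const_mul r).exp
  -- `V s * exp (r s)` has nonpositive right derivative, so the constant `V 0` is a barrier.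
  have hmain := image_le_of_deriv_right_le_deriv_boundary
    (f := fun s => V s * Real.exp (r * s))
    (f' := fun s => V' s * Real.exp (r * s) + V s * (Real.exp (r * s) * r)) (a := 0) (b := t)
    (B := fun _ => V 0) (B' := fun _ => 0) ?_ ?_ (by simp) continuousOn_const
    (fun s _ => hasDerivWithinAt_const _ _ _) ?_ (right_mem_Icc.2 ht)
  · have h1 : V t = V t * Real.exp (r * t) * Real.exp (-r * t) := by
      rw [mul_assoc, ← Real.exp_add]
      simp
    rw [h1]
    exact mul_le_mul_of_nonneg_right hmain (Real.exp_pos _).le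
  · exact (hV.mono Icc_subset_Ici_self).mul (by fun_prop)
  · exact fun s hs => (hd s hs.1).mul (hexp s).hasDerivWithinAt
  · intro s hs
    have h1 := mul_le_mul_of_nonneg_right (hle s hs.1) (Real.exp_pos (r * s)).le
    linarith

end RightDerivative

/-! ### Scalar inequalities: choice of Lyapunov weights and meaning of `τ₀`. -/

section Scalar

/-- The scalar inequality behind the Lyapunov estimate: `a`, `b`, `c` stand for the norms of the
output error, of the integral error and of the sampling error. -/
theorem exists_lyapunov_parameters {m w l ξ : ℝ} (hm : 0 < m) (hmw : m ≤ w)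
    (hξ : 4 * w ^ 2 + 2 * l ^ 2 + 1 < 8 * m * ξ) :
    ∃ θ δ : ℝ, 1 ≤ θ ∧ 0 < δ ∧ ∀ a b c : ℝ,
      8 * (ξ ^ 2 + (ξ - 1) ^ 2) * c ^ 2 ≤ a ^ 2 + b ^ 2 →
        -(θ * m * a ^ 2) + (θ - 1) * (l * a * c) + w * a * b - b ^ 2 + θ * (c * b)
          ≤ -δ * (a ^ 2 + b ^ 2) := by
  -- The natural weight is `θ = ξ`, but `θ ≥ 1` is required, so `θ = 1` when `ξ < 1`. For `θ = ξ`,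
  -- Young's inequality on the three cross terms leaves `-1/8` on `b ^ 2`, and on `a ^ 2` exactly
  -- the hypothesis on `ξ` divided by 8.
  rcases le_or_gt 1 ξ with h1 | h1
  · refine ⟨ξ, min (ξ * m - w ^ 2 / 2 - l ^ 2 / 4 - 1 / 8) (1 / 8), h1,
      lt_min (by linarith) (by norm_num), fun a b c hc => ?_⟩
    have e1 := min_le_left (ξ * m - w ^ 2 / 2 - l ^ 2 / 4 - 1 / 8) (1 / 8 : ℝ)
    have e2 := min_le_right (ξ * m - w ^ 2 / 2 - l ^ 2 / 4 - 1 / 8) (1 / 8 : ℝ)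
    set d := min (ξ * m - w ^ 2 / 2 - l ^ 2 / 4 - 1 / 8) (1 / 8 : ℝ)
    have f1 := mul_le_mul_of_nonneg_right e1 (sq_nonneg a)
    have f2 := mul_le_mul_of_nonneg_right e2 (sq_nonneg b)
    have g1 := sq_nonneg (l * a / 2 - (ξ - 1) * c)
    have g2 := sq_nonneg (b / 2 - ξ * c)
    have g3 := sq_nonneg (w * a - b)
    nlinarith
  · have hw : 0 < w := hm.trans_le hmw
    have hξ0 : 0 < ξ := by
      by_contra! h
      nlinarith [mul_nonneg hm.le (neg_nonneg.2 h), sq_nonneg w, sq_nonneg l]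
    -- From `8wξ ≥ 8mξ > 4w² + 1 ≥ 4w`; this is where `m ≤ w` enters.
    have hξ2 : 1 / 2 < ξ := by
      nlinarith [mul_le_mul_of_nonneg_right hmw hξ0.le, sq_nonneg (2 * w - 1), sq_nonneg l]
    set g := ξ ^ 2 + (ξ - 1) ^ 2 with hg
    have hg2 : 1 / 2 ≤ g := by nlinarith [sq_nonneg (2 * ξ - 1)]
    have hg0 : 0 < g := by linarith
    -- This makes the sampling share `3 / 32 / g` at most `1 / (8 * ξ)`, which the summand `1` in
    -- the hypothesis on `ξ` pays for. The point `11/16` minimizes `g - 3 / 4 * ξ`.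
    have k1 : 3 / 4 * ξ ≤ g := by nlinarith [sq_nonneg (ξ - 11 / 16)]
    set d₁ := m - w ^ 2 / (2 * ξ) - 3 / 32 / g with hd₁
    set d₂ := 2 / 3 - ξ / 2 - 3 / 32 / g with hd₂
    have hd₁0 : 0 < d₁ := by
      have p1 : 3 / 32 / g ≤ 1 / (8 * ξ) := by
        rw [div_le_div_iff₀ hg0 (by linarith)]
        linarith
      have p2 : w ^ 2 / (2 * ξ) + 1 / (8 * ξ) < m := by
        have : w ^ 2 / (2 * ξ) + 1 / (8 * ξ) = (4 * w ^ 2 + 1) / (8 * ξ) := by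
          field_simp
          ring
        rw [this, div_lt_iff₀ (by linarith)]
        nlinarith [sq_nonneg l]
      linarith
    have hd₂0 : 0 < d₂ := by
      have : 3 / 32 / g < 2 / 3 - ξ / 2 := by
        rw [div_lt_iff₀ hg0, hg]
        nlinarith [mul_pos (sub_pos.2 h1) (sub_pos.2 hξ2), sq_nonneg (ξ - 3 / 4),
          mul_nonneg (sub_nonneg.2 h1.le) (sq_nonneg (2 * ξ - 1))]
      linarith
    refine ⟨1, min d₁ d₂, le_rfl, lt_min hd₁0 hd₂0, fun a b c hc => ?_⟩
    have f1 := mul_le_mul_of_nonneg_right (min_le_left d₁ d₂) (sq_nonneg a)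
    have f2 := mul_le_mul_of_nonneg_right (min_le_right d₁ d₂) (sq_nonneg b)
    have q1 : w * a * b ≤ w ^ 2 / (2 * ξ) * a ^ 2 + ξ / 2 * b ^ 2 := by
      have : w ^ 2 / (2 * ξ) * a ^ 2 + ξ / 2 * b ^ 2 - w * a * b
          = (w * a - ξ * b) ^ 2 / (2 * ξ) := by
        field_simp
        ring
      have h0 : 0 ≤ (w * a - ξ * b) ^ 2 / (2 * ξ) := by positivity
      linarith
    have q2 : c ^ 2 ≤ 1 / 8 / g * (a ^ 2 + b ^ 2) := by
      have : 1 / 8 / g * (a ^ 2 + b ^ 2) = (a ^ 2 + b ^ 2) / (8 * g) := by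
        field_simp
      rw [this, le_div_iff₀ (by linarith)]
      linarith
    have q3 : 3 / 4 * (1 / 8 / g * (a ^ 2 + b ^ 2)) = 3 / 32 / g * (a ^ 2 + b ^ 2) := by ring
    have q4 : c * b ≤ 1 / 3 * b ^ 2 + 3 / 4 * c ^ 2 := by nlinarith [sq_nonneg (2 * b - 3 * c)]
    nlinarith

/-- `tau0` is the time at which the Grönwall factor reaches this quotient. -/
theorem exp_sub_one_le_of_le_tau0 {w l ξ T : ℝ} (hw : 0 < w) (hl : 0 ≤ l) (hT : T ≤ tau0 w l ξ) :
    Real.exp ((w + 1) * T) - 1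
      ≤ (w + 1) * epsilon ξ / (w + 1 + √2 * l + √2 * l * epsilon ξ) := by
  have hε : 0 ≤ epsilon ξ := by unfold epsilon; positivity
  have hpos : 0 < 1 + (w + 1) * epsilon ξ / (w + 1 + √2 * l + √2 * l * epsilon ξ) := by positivity
  have h1 : (w + 1) * T
      ≤ Real.log (1 + (w + 1) * epsilon ξ / (w + 1 + √2 * l + √2 * l * epsilon ξ)) := by
    have := mul_le_mul_of_nonneg_left hT (by linarith : 0 ≤ w + 1)
    rwa [tau0, ← mul_assoc, mul_one_div_cancel (by linarith), one_mul] at this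
  have h2 := Real.exp_le_exp.2 h1
  rw [Real.exp_log hpos] at h2
  linarith

theorem epsilon_sq (ξ : ℝ) : 8 * (ξ ^ 2 + (ξ - 1) ^ 2) * epsilon ξ ^ 2 = 1 := by
  have h : 0 < ξ ^ 2 + (ξ - 1) ^ 2 := by nlinarith [sq_nonneg (2 * ξ - 1)]
  unfold epsilon
  rw [div_pow, mul_pow, Real.sq_sqrt (by linarith)]
  field_simp
  norm_num

end Scalar

/-! ### Growth of the error field, positive symmetric operators and the Lyapunov derivative. -/

section Operator

/-- The coupling enters the two components with opposite signs, as `(-p, p)`, of norm `√2 ‖p‖`: the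
source of `√2 λ_N` in `τ₀`. The rest, `(-h - ζ, 0)`, grows at rate `w + 1`. -/
theorem norm_toLp_add_neg_le {E : Type*} [NormedAddCommGroup E] {w l : ℝ} (hw : 0 ≤ w) {z ζ h v p : E}
    (hh : ‖h‖ ≤ w * ‖z‖) (hp : ‖p‖ ≤ l * ‖v‖) :
    ‖WithLp.toLp 2 (-h - p - ζ, p)‖ ≤ (w + 1) * ‖WithLp.toLp 2 (z, ζ)‖ + √2 * l * ‖v‖ := by
  have hz : ‖z‖ ≤ ‖WithLp.toLp 2 (z, ζ)‖ := WithLp.norm_fst_le E (WithLp.toLp 2 (z, ζ))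
  have hζ : ‖ζ‖ ≤ ‖WithLp.toLp 2 (z, ζ)‖ := WithLp.norm_snd_le E (WithLp.toLp 2 (z, ζ))
  have h1 : WithLp.toLp 2 (-h - p - ζ, p)
      = WithLp.toLp 2 (-h - ζ, (0 : E)) + WithLp.toLp 2 (-p, p) := by
    rw [← WithLp.toLp_add, Prod.mk_add_mk]
    congr 2
    · abel
    · simp
  have h2 : ‖WithLp.toLp 2 (-h - ζ, (0 : E))‖ ≤ ‖h‖ + ‖ζ‖ := by
    rw [WithLp.prod_norm_eq_of_L2]
    change √(‖-h - ζ‖ ^ 2 + ‖(0 : E)‖ ^ 2) ≤ _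
    rw [norm_zero, zero_pow two_ne_zero, add_zero, Real.sqrt_sq (norm_nonneg _)]
    simpa using norm_sub_le (-h) ζ
  have h3 : ‖WithLp.toLp 2 (-p, p)‖ = √2 * ‖p‖ := by
    rw [WithLp.prod_norm_eq_of_L2]
    change √(‖-p‖ ^ 2 + ‖p‖ ^ 2) = _
    rw [norm_neg, ← two_mul, Real.sqrt_mul (by norm_num), Real.sqrt_sq (norm_nonneg _)]
  have h4 := mul_le_mul_of_nonneg_left hp (Real.sqrt_nonneg 2)
  have h5 := mul_le_mul_of_nonneg_left hz hw
  rw [h1]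
  refine (norm_add_le _ _).trans ?_
  rw [h3]
  nlinarith

variable {E : Type*} [NormedAddCommGroup E] [InnerProductSpace ℝ E]

/-- Cocoercivity of a positive symmetric operator with a bounded quadratic form. -/
theorem cocoercive_of_inner_le {L : E →ₗ[ℝ] E} (hL : L.IsSymmetric)
    (hpos : ∀ z, 0 ≤ inner ℝ (L z) z) {l : ℝ} (hle : ∀ z, inner ℝ (L z) z ≤ l * ‖z‖ ^ 2)
    (s : ℝ) (z : E) : (2 * s - s ^ 2 * l) * ‖L z‖ ^ 2 ≤ inner ℝ (L z) z := by
  -- Positivity at a gradient step from `z`, with `s` left free; the last term of the expansion is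
  -- bounded by `hle` at `L z`.
  have h1 := hpos (z - s • L z)
  have h2 : inner ℝ (L (L z)) z = ‖L z‖ ^ 2 := by
    rw [hL, real_inner_self_eq_norm_sq]
  simp only [map_sub, map_smul, inner_sub_left, inner_sub_right, real_inner_smul_left,
    real_inner_smul_right, h2, real_inner_self_eq_norm_sq] at h1
  have h3 := mul_le_mul_of_nonneg_left (hle (L z)) (sq_nonneg s)
  nlinarith

theorem norm_apply_le_of_inner_le {L : E →ₗ[ℝ] E} (hL : L.IsSymmetric)
    (hpos : ∀ z, 0 ≤ inner ℝ (L z) z) {l : ℝ} (hl : 0 ≤ l)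
    (hle : ∀ z, inner ℝ (L z) z ≤ l * ‖z‖ ^ 2) (z : E) : ‖L z‖ ≤ l * ‖z‖ := by
  rcases hl.eq_or_lt with h0 | h0
  · have h1 := cocoercive_of_inner_le hL hpos hle 1 z
    have h2 := hle z
    rw [← h0] at h1 h2 ⊢
    nlinarith [norm_nonneg (L z)]
  · have h1 := cocoercive_of_inner_le hL hpos hle l⁻¹ z
    have h2 : 2 * l⁻¹ - l⁻¹ ^ 2 * l = l⁻¹ := by
      field_simp
      norm_num
    rw [h2, inv_mul_le_iff₀ h0] at h1
    have h3 := mul_le_mul_of_nonneg_left (hle z) hl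
    refine abs_le_of_sq_le_sq' ?_ (by positivity) |>.2
    nlinarith

/-- A symmetric right inverse of a positive symmetric operator on the complement of its kernel. -/
theorem exists_symmetric_rightInverse [FiniteDimensional ℝ E] {L : E →ₗ[ℝ] E}
    (hL : L.IsSymmetric) (hpos : ∀ z, 0 ≤ inner ℝ (L z) z) :
    ∃ P : E →L[ℝ] E, (∀ x y, inner ℝ (P x) y = inner ℝ x (P y)) ∧
      ∀ x ∈ (LinearMap.ker L)ᗮ, L (P x) = x := by
  set K := LinearMap.ker L with hK
  -- Adding the orthogonal projection onto the kernel makes `L` invertible without losing symmetry;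
  -- `P` is the inverse of `L + Q`.
  set Q : E →ₗ[ℝ] E := (K.starProjection : E →ₗ[ℝ] E) with hQ
  have hQK : ∀ x, Q x ∈ K := fun x => K.starProjection_apply_mem x
  have hQs : Q.IsSymmetric := K.starProjection_isSymmetric
  have hQQ : ∀ x, Q (Q x) = Q x := fun x => K.starProjection_eq_self_iff.2 (hQK x)
  have hQn : ∀ x, inner ℝ (Q x) x = ‖Q x‖ ^ 2 := fun x => by
    rw [← real_inner_self_eq_norm_sq, hQs x (Q x), hQQ, hQs x x]
  have hinj : Function.Injective (L + Q) := by
    refine (injective_iff_map_eq_zero _).2 fun x hx => ?_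
    have h1 : inner ℝ (L x) x + inner ℝ (Q x) x = 0 := by
      rw [← inner_add_left, ← LinearMap.add_apply, hx, inner_zero_left]
    rw [hQn] at h1
    have h2 : Q x = 0 := by
      have := hpos x
      have h3 : ‖Q x‖ ^ 2 = 0 := le_antisymm (by linarith) (sq_nonneg _)
      simpa using h3
    have h4 : L x = 0 := by simpa [h2] using hx
    have h5 : Q x = x := K.starProjection_eq_self_iff.2 (LinearMap.mem_ker.2 h4)
    rw [← h5, h2]
  set e := LinearEquiv.ofInjectiveEndo (L + Q) hinj with he
  have hee : ∀ x, L (e.symm x) + Q (e.symm x) = x := fun x => e.apply_symm_apply x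
  refine ⟨(e.symm : E →ₗ[ℝ] E).toContinuousLinearMap, fun x y => ?_, fun x hx => ?_⟩
  · change inner ℝ (e.symm x) y = inner ℝ x (e.symm y)
    conv_lhs => rw [← hee y]
    conv_rhs => rw [← hee x]
    rw [inner_add_left, inner_add_right, hL, hQs]
  · change L (e.symm x) = x
    have h1 : inner ℝ x (Q (e.symm x)) = 0 := by
      rw [real_inner_comm]
      exact hx _ (hQK _)
    have h2 : inner ℝ (L (e.symm x)) (Q (e.symm x)) = 0 := by
      rw [hL, LinearMap.mem_ker.1 (hQK _), inner_zero_right]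
    have h3 : Q (e.symm x) = 0 := by
      rw [← hee x, inner_add_left, hee x, h2, zero_add] at h1
      exact inner_self_eq_zero.1 h1
    simpa [h3] using hee x

/-- The weights `(θ - 1) / 2`, `1 / 2`, `θ / 2` are matched so that the products `⟨z, ζ⟩` cancel:
`-(θ - 1)` and `-1` from the first two parts against `θ` from the third. -/
theorem lyapunov_deriv_eq (L : E →ₗ[ℝ] E) (θ : ℝ) (z ζ h e : E) :
    (θ - 1) / 2 * (inner ℝ z (-h - L (z + e) - ζ) + inner ℝ (-h - L (z + e) - ζ) z)
      + 1 / 2 * (inner ℝ (z + ζ) (-h - L (z + e) - ζ + L (z + e))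
        + inner ℝ (-h - L (z + e) - ζ + L (z + e)) (z + ζ))
      + θ / 2 * (inner ℝ z ζ + inner ℝ e ζ + (inner ℝ z ζ + inner ℝ e ζ))
    = -(θ * inner ℝ z h) - (θ - 1) * inner ℝ (L z) z - (θ - 1) * inner ℝ (L e) z
      - inner ℝ ζ h - ‖ζ‖ ^ 2 + θ * inner ℝ e ζ := by
  have h1 : -h - L (z + e) - ζ + L (z + e) = -h - ζ := by abel
  rw [h1, real_inner_comm (-h - L (z + e) - ζ) z, real_inner_comm (-h - ζ) (z + ζ)]
  simp only [map_add, inner_add_right, inner_sub_left, inner_neg_left, inner_add_left,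
    real_inner_self_eq_norm_sq]
  rw [real_inner_comm z h, real_inner_comm ζ h, real_inner_comm z ζ]
  ring

end Operator

/-! ### Exponential stability of the abstract sampled error system. -/

section SampledSystem

variable {E : Type*} [NormedAddCommGroup E] [InnerProductSpace ℝ E] [FiniteDimensional ℝ E]

/-- `z, ζ` solve `ż = -H z - L ẑ - ζ`, `ζ̇ = L ẑ` with right derivatives, where `ẑ` samples `z` with
period `Δ`, and `ζ` is orthogonal to the kernel of `L`. -/
structure IsSampledSolution (L : E →ₗ[ℝ] E) (H : E → E) (Δ : ℝ) (z ζ : ℝ → E) : Prop where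
  continuousOn_fst : ContinuousOn z (Ici 0)
  continuousOn_snd : ContinuousOn ζ (Ici 0)
  deriv_fst : ∀ k : ℕ, ∀ t ∈ Ico (k * Δ) ((k + 1) * Δ),
    HasDerivWithinAt z (-H (z t) - L (z (k * Δ)) - ζ t) (Ici t) t
  deriv_snd : ∀ k : ℕ, ∀ t ∈ Ico (k * Δ) ((k + 1) * Δ),
    HasDerivWithinAt ζ (L (z (k * Δ))) (Ici t) t
  mem_orthogonal : ∀ t, 0 ≤ t → ζ t ∈ (LinearMap.ker L)ᗮ

theorem exists_mem_Ico_mul {Δ t : ℝ} (hΔ : 0 < Δ) (ht : 0 ≤ t) :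
    ∃ k : ℕ, t ∈ Ico (k * Δ) ((k + 1) * Δ) := by
  refine ⟨⌊t / Δ⌋₊, ?_, ?_⟩
  · exact (le_div_iff₀ hΔ).1 (Nat.floor_le (by positivity))
  · exact (div_lt_iff₀ hΔ).1 (Nat.lt_floor_add_one _)

/-- The sampling error is dominated by the current state. -/
theorem IsSampledSolution.sampling_error_le {L : E →ₗ[ℝ] E} {H : E → E} {w l ξ Δ : ℝ}
    {z ζ : ℝ → E} (hsol : IsSampledSolution L H Δ z ζ) (hw : 0 < w) (hl : 0 ≤ l)
    (hLn : ∀ v, ‖L v‖ ≤ l * ‖v‖) (hHc : Continuous H) (hHw : ∀ v, ‖H v‖ ≤ w * ‖v‖)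
    (hΔ : Δ ∈ Ioc 0 (tau0 w l ξ)) (k : ℕ) {t : ℝ} (ht : t ∈ Ico (k * Δ) ((k + 1) * Δ)) :
    8 * (ξ ^ 2 + (ξ - 1) ^ 2) * ‖z (k * Δ) - z t‖ ^ 2 ≤ ‖z t‖ ^ 2 + ‖ζ t‖ ^ 2 := by
  have hk0 : (0 : ℝ) ≤ k * Δ := mul_nonneg k.cast_nonneg hΔ.1.le
  have hsub : Ico (k * Δ) ((k + 1) * Δ) ⊆ Ici 0 := fun s hs => hk0.trans hs.1
  have hzc := hsol.continuousOn_fst.mono hsub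
  have hζc := hsol.continuousOn_snd.mono hsub
  set φ := (WithLp.prodContinuousLinearEquiv 2 ℝ E E).symm with hφ
  set X : ℝ → WithLp 2 (E × E) := fun s => φ (z s, ζ s) with hX
  set v := z (k * Δ) with hv
  have hXe : ∀ s, X s = WithLp.toLp 2 (z s, ζ s) := fun s => rfl
  have hmain := norm_sub_le_of_norm_deriv_right_le (X := X)
    (X' := fun s => φ (-H (z s) - L v - ζ s, L v)) (a := k * Δ) (b := (k + 1) * Δ)
    (K := w + 1) (C := √2 * l * ‖v‖) (by linarith) ht
    (φ.continuous.comp_continuousOn (hzc.prodMk hζc)) ?_ ?_ ?_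
  rotate_left
  · intro s hs
    have h1 := (hsol.deriv_fst k s hs).prodMk (hsol.deriv_snd k s hs)
    exact (φ : E × E →L[ℝ] WithLp 2 (E × E)).hasFDerivAt.comp_hasDerivWithinAt s h1
  · refine φ.continuous.comp_continuousOn (ContinuousOn.prodMk ?_ continuousOn_const)
    exact (((hHc.comp_continuousOn hzc).neg).sub continuousOn_const).sub hζc
  · intro s _
    exact norm_toLp_add_neg_le hw.le (hHw _) (hLn _)
  set ε := epsilon ξ with hε
  have hε0 : 0 < ε := by
    have := epsilon_sq ξ
    have h0 : 0 ≤ ε := by rw [hε]; unfold epsilon; positivity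
    refine h0.lt_of_ne' fun h => ?_
    rw [← hε, h] at this
    norm_num at this
  set b := √2 * l with hb
  have hb0 : 0 ≤ b := by positivity
  have hexp := exp_sub_one_le_of_le_tau0 (ξ := ξ) (T := t - k * Δ) hw hl
    (le_trans (by linarith [ht.2]) hΔ.2)
  rw [← hε, ← hb] at hexp
  set c := ‖v - z t‖ with hc
  have hcX : c ≤ ‖X (k * Δ) - X t‖ := WithLp.norm_fst_le E (X (k * Δ) - X t)
  have hzX : ‖z t‖ ≤ ‖X t‖ := WithLp.norm_fst_le E (X t)
  -- The sampled value is traded for the current state plus the error itself, so that `c` appears on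
  -- both sides and can be absorbed.
  have hvle : ‖v‖ ≤ ‖X t‖ + c := by
    have := norm_le_norm_sub_add v (z t)
    linarith
  have hw1 : 0 < w + 1 := by linarith
  have hD : 0 < w + 1 + b + b * ε := by positivity
  have hce : c ≤ ((w + 1) * ‖X t‖ + b * (‖X t‖ + c)) / (w + 1)
      * ((w + 1) * ε / (w + 1 + b + b * ε)) := by
    refine hcX.trans (hmain.trans ?_)
    have hc0 : 0 ≤ c := norm_nonneg _
    have hexp0 : 0 ≤ Real.exp ((w + 1) * (t - k * Δ)) - 1 :=
      sub_nonneg.2 (Real.one_le_exp (mul_nonneg hw1.le (sub_nonneg.2 ht.1)))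
    gcongr
  have hce2 : ((w + 1) * ‖X t‖ + b * (‖X t‖ + c)) / (w + 1)
      * ((w + 1) * ε / (w + 1 + b + b * ε))
      = ((w + 1) * ‖X t‖ + b * (‖X t‖ + c)) * ε / (w + 1 + b + b * ε) := by
    field_simp
  rw [hce2, le_div_iff₀ hD] at hce
  -- The term `b * ε` in the denominator of `τ₀` exactly cancels the `c` on the right.
  have hcε : c ≤ ε * ‖X t‖ := by
    have h1 : (w + 1 + b) * c ≤ (w + 1 + b) * (ε * ‖X t‖) := by linarith
    exact le_of_mul_le_mul_left h1 (by linarith)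
  have hsq : c ^ 2 ≤ ε ^ 2 * ‖X t‖ ^ 2 := by
    rw [← mul_pow]
    exact pow_le_pow_left₀ (norm_nonneg _) hcε 2
  have hXsq : ‖X t‖ ^ 2 = ‖z t‖ ^ 2 + ‖ζ t‖ ^ 2 := by
    rw [hXe, WithLp.prod_norm_sq_eq_of_L2]
    rfl
  have hg : 0 ≤ 8 * (ξ ^ 2 + (ξ - 1) ^ 2) := by positivity
  have h2 := mul_le_mul_of_nonneg_left hsq hg
  rw [← mul_assoc, hε, epsilon_sq, one_mul, hXsq] at h2
  exact h2

/-- Exponential stability of the sampled system, with a rate independent of period and solution. -/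
theorem exists_rate_of_isSampledSolution {L : E →ₗ[ℝ] E} (hL : L.IsSymmetric)
    (hpos : ∀ v, 0 ≤ inner ℝ (L v) v) {H : E → E} {m w l ξ : ℝ} (hl : 0 ≤ l)
    (hle : ∀ v, inner ℝ (L v) v ≤ l * ‖v‖ ^ 2) (hm : 0 < m) (hmw : m ≤ w)
    (hξ : 4 * w ^ 2 + 2 * l ^ 2 + 1 < 8 * m * ξ) (hHc : Continuous H)
    (hHm : ∀ v, m * ‖v‖ ^ 2 ≤ inner ℝ v (H v)) (hHw : ∀ v, ‖H v‖ ≤ w * ‖v‖) :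
    ∃ c : ℝ, 0 < c ∧ ∀ Δ ∈ Ioc 0 (tau0 w l ξ), ∀ z ζ : ℝ → E, IsSampledSolution L H Δ z ζ →
      ∃ M : ℝ, ∀ t, 0 ≤ t → ‖z t‖ ≤ M * Real.exp (-c * t) := by
  have hLn := norm_apply_le_of_inner_le hL hpos hl hle
  obtain ⟨P, hPs, hLP⟩ := exists_symmetric_rightInverse hL hpos
  obtain ⟨θ, δ, hθ, hδ, hscal⟩ := exists_lyapunov_parameters (l := l) hm hmw hξ
  set C := (θ - 1) / 2 + 1 + θ / 2 * ‖P‖ with hC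
  have hC0 : 0 < C := by
    have : 0 ≤ θ / 2 * ‖P‖ := by positivity
    linarith
  -- `V` decays at rate `δ / C` and controls `‖z‖ ^ 2`, hence the half. The rate is fixed before `Δ`
  -- and the solution.
  refine ⟨δ / C / 2, by positivity, fun Δ hΔ z ζ hsol => ?_⟩
  set V : ℝ → ℝ := fun t => (θ - 1) / 2 * inner ℝ (z t) (z t)
    + 1 / 2 * inner ℝ (z t + ζ t) (z t + ζ t) + θ / 2 * inner ℝ (ζ t) (P (ζ t)) with hV
  have hVupper : ∀ t, V t ≤ C * (‖z t‖ ^ 2 + ‖ζ t‖ ^ 2) := by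
    intro t
    have h1 : ‖z t + ζ t‖ ^ 2 ≤ 2 * (‖z t‖ ^ 2 + ‖ζ t‖ ^ 2) := by
      have := norm_add_le (z t) (ζ t)
      nlinarith [sq_nonneg (‖z t‖ - ‖ζ t‖), norm_nonneg (z t + ζ t)]
    have h2 : inner ℝ (ζ t) (P (ζ t)) ≤ ‖P‖ * ‖ζ t‖ ^ 2 := by
      refine (real_inner_le_norm _ _).trans ?_
      have := mul_le_mul_of_nonneg_left (P.le_opNorm (ζ t)) (norm_nonneg (ζ t))
      linarith
    have h3 := mul_le_mul_of_nonneg_left h2 (by linarith : 0 ≤ θ / 2)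
    have h4 : 0 ≤ (θ - 1) / 2 * ‖ζ t‖ ^ 2 := mul_nonneg (by linarith) (sq_nonneg _)
    have h5 : 0 ≤ θ / 2 * ‖P‖ * ‖z t‖ ^ 2 := by positivity
    simp only [hV, hC, real_inner_self_eq_norm_sq]
    nlinarith
  have hVlower : ∀ t, 0 ≤ t → ‖z t‖ ^ 2 ≤ (4 + 4 * (l + 1)) * V t := by
    intro t ht
    -- Since `L (P ζ) = ζ`, cocoercivity bounds `⟨ζ, P ζ⟩` below by a multiple of `‖ζ‖ ^ 2`. The
    -- parameter `(l + 1)⁻¹` also covers `l = 0`.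
    have h1 := cocoercive_of_inner_le hL hpos hle (l + 1)⁻¹ (P (ζ t))
    rw [hLP _ (hsol.mem_orthogonal t ht)] at h1
    have h2 : (l + 1)⁻¹ ≤ 2 * (l + 1)⁻¹ - (l + 1)⁻¹ ^ 2 * l := by
      have : 2 * (l + 1)⁻¹ - (l + 1)⁻¹ ^ 2 * l - (l + 1)⁻¹ = (l + 1)⁻¹ ^ 2 := by
        field_simp
        ring
      linarith [sq_nonneg (l + 1)⁻¹]
    have h3 := (mul_le_mul_of_nonneg_right h2 (sq_nonneg ‖ζ t‖)).trans h1
    rw [inv_mul_le_iff₀ (by linarith)] at h3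
    set p := inner ℝ (ζ t) (P (ζ t)) with hp
    have hp0 : 0 ≤ p := by
      by_contra! hneg
      nlinarith [sq_nonneg ‖ζ t‖]
    have h4 : ‖z t‖ ^ 2 ≤ 2 * ‖z t + ζ t‖ ^ 2 + 2 * ‖ζ t‖ ^ 2 := by
      have h5 : ‖z t‖ ≤ ‖z t + ζ t‖ + ‖ζ t‖ := by
        simpa using norm_sub_le (z t + ζ t) (ζ t)
      nlinarith [sq_nonneg (‖z t + ζ t‖ - ‖ζ t‖), norm_nonneg (z t)]
    have h6 : 1 / 2 * ‖z t + ζ t‖ ^ 2 + 1 / 2 * p ≤ V t := by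
      have h7 : 0 ≤ (θ - 1) / 2 * ‖z t‖ ^ 2 := mul_nonneg (by linarith) (sq_nonneg _)
      have h8 : 0 ≤ (θ - 1) / 2 * p := mul_nonneg (by linarith) hp0
      simp only [hV, real_inner_self_eq_norm_sq, ← hp]
      linarith
    have h9 := mul_le_mul_of_nonneg_left h6 (by linarith : 0 ≤ 4 + 4 * (l + 1))
    have h10 : 0 ≤ (l + 1) * ‖z t + ζ t‖ ^ 2 := by positivity
    linarith
  have hderiv : ∀ t, 0 ≤ t → ∃ d, HasDerivWithinAt V d (Ici t) t ∧ d ≤ -(δ / C) * V t := by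
    intro t ht
    obtain ⟨k, hk⟩ := exists_mem_Ico_mul hΔ.1 ht
    have hz := hsol.deriv_fst k t hk
    have hζ := hsol.deriv_snd k t hk
    have hPζ := P.hasFDerivAt.comp_hasDerivWithinAt t hζ
    have hs := hz.add hζ
    refine ⟨_, (((hz.inner ℝ hz).const_mul ((θ - 1) / 2)).add
      ((hs.inner ℝ hs).const_mul (1 / 2))).add ((hζ.inner ℝ hPζ).const_mul (θ / 2)), ?_⟩
    have herr := hsol.sampling_error_le (hm.trans_le hmw) hl hLn hHc hHw hΔ k hk
    have h1 := hscal _ _ _ herr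
    obtain ⟨e, he⟩ : ∃ e, z (k * Δ) = z t + e := ⟨z (k * Δ) - z t, by abel⟩
    have he' : z (k * Δ) - z t = e := by rw [he]; abel
    rw [he'] at h1
    -- Symmetry moves `P` and then `L` onto `ζ`, where they cancel because `ζ` is orthogonal to the
    -- kernel.
    have hP1 : inner ℝ (ζ t) (P (L (z (k * Δ)))) = inner ℝ (z t) (ζ t) + inner ℝ e (ζ t) := by
      rw [← hPs, real_inner_comm, hL, hLP _ (hsol.mem_orthogonal t ht), he, inner_add_left]
    have hP2 : inner ℝ (L (z (k * Δ))) (P (ζ t)) = inner ℝ (z t) (ζ t) + inner ℝ e (ζ t) := by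
      rw [hL, hLP _ (hsol.mem_orthogonal t ht), he, inner_add_left]
    have b1 := mul_le_mul_of_nonneg_left (hHm (z t)) (by linarith : 0 ≤ θ)
    have b2 : 0 ≤ (θ - 1) * inner ℝ (L (z t)) (z t) := mul_nonneg (by linarith) (hpos _)
    have b3 : -((θ - 1) * inner ℝ (L e) (z t)) ≤ (θ - 1) * (l * ‖z t‖ * ‖e‖) := by
      have h2 : -inner ℝ (L e) (z t) ≤ l * ‖z t‖ * ‖e‖ := by
        refine (neg_le_abs _).trans ((abs_real_inner_le_norm _ _).trans ?_)
        nlinarith [mul_le_mul_of_nonneg_right (hLn e) (norm_nonneg (z t))]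
      nlinarith [mul_le_mul_of_nonneg_left h2 (by linarith : 0 ≤ θ - 1)]
    have b4 : -inner ℝ (ζ t) (H (z t)) ≤ w * ‖z t‖ * ‖ζ t‖ := by
      refine (neg_le_abs _).trans ((abs_real_inner_le_norm _ _).trans ?_)
      nlinarith [mul_le_mul_of_nonneg_left (hHw (z t)) (norm_nonneg (ζ t))]
    have b5 := mul_le_mul_of_nonneg_left (real_inner_le_norm e (ζ t)) (by linarith : 0 ≤ θ)
    have b6 := hVupper t
    have b7 : -δ * (‖z t‖ ^ 2 + ‖ζ t‖ ^ 2) ≤ -(δ / C) * V t := by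
      have h2 := mul_le_mul_of_nonneg_left b6 (by positivity : 0 ≤ δ / C)
      have h3 : δ / C * (C * (‖z t‖ ^ 2 + ‖ζ t‖ ^ 2)) = δ * (‖z t‖ ^ 2 + ‖ζ t‖ ^ 2) := by
        field_simp
      linarith
    refine le_trans (le_trans ?_ h1) b7
    have hd := lyapunov_deriv_eq L θ (z t) (ζ t) (H (z t)) e
    rw [← he] at hd
    simp only [Pi.add_apply, Function.comp_apply, hP1, hP2]
    rw [hd]
    linarith
  choose! V' hV' hV'le using hderiv
  have hVc : ContinuousOn V (Ici 0) := by
    have hz := hsol.continuousOn_fst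
    have hζ := hsol.continuousOn_snd
    have hPζ := P.continuous.comp_continuousOn hζ
    exact ((continuousOn_const.mul (hz.inner hz)).add
      (continuousOn_const.mul ((hz.add hζ).inner (hz.add hζ)))).add
      (continuousOn_const.mul (hζ.inner hPζ))
  refine ⟨√((4 + 4 * (l + 1)) * V 0), fun t ht => ?_⟩
  have h1 := le_mul_exp_of_deriv_right_le hVc hV' hV'le ht
  have h2 : ‖z t‖ ^ 2 ≤ (4 + 4 * (l + 1)) * V 0 * Real.exp (-(δ / C / 2) * t) ^ 2 := by
    rw [← Real.exp_nat_mul]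
    have h3 : ((2 : ℕ) : ℝ) * (-(δ / C / 2) * t) = -(δ / C) * t := by
      push_cast
      ring
    rw [h3, mul_assoc]
    exact (hVlower t ht).trans (mul_le_mul_of_nonneg_left h1 (by linarith))
  rw [← Real.sqrt_sq (norm_nonneg (z t)), ← Real.sqrt_sq (Real.exp_pos (-(δ / C / 2) * t)).le,
    ← Real.sqrt_mul' _ (sq_nonneg _)]
  exact Real.sqrt_le_sqrt h2

end SampledSystem

/-! ### Spectral bound and kernel of the graph Laplacian on stacked outputs. -/

section Laplacian

variable {N : ℕ} (G : CommGraph N)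

theorem CommGraph.a_nonneg (i j : Fin N) : 0 ≤ G.a i j := by
  by_cases h : G.graph.Adj i j
  · exact (G.pos_of_adj i j h).le
  · exact (G.zero_of_not_adj i j h).ge

theorem CommGraph.laplacian_isHermitian : G.laplacian.IsHermitian := by
  ext i j
  rcases eq_or_ne i j with rfl | h
  · simp
  · simp [CommGraph.laplacian, Matrix.diagonal_apply_ne _ h, Matrix.diagonal_apply_ne _ h.symm,
      G.symm i j]

theorem CommGraph.laplacian_mulVec_apply (v : Fin N → ℝ) (i : Fin N) :
    (G.laplacian.mulVec v) i = ∑ j, G.a i j * (v i - v j) := by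
  rw [CommGraph.laplacian, Matrix.sub_mulVec, Pi.sub_apply, Matrix.mulVec_diagonal]
  simp only [Matrix.mulVec, dotProduct, mul_sub, Finset.sum_sub_distrib, Finset.sum_mul]
  simp only [G.symm i]

/-- The Rayleigh quotient of the Laplacian is at most its largest eigenvalue. -/
theorem CommGraph.dotProduct_laplacian_le (v : Fin N → ℝ) :
    v ⬝ᵥ (G.laplacian.mulVec v) ≤ G.lambdaMax * (v ⬝ᵥ v) := by
  have hpsd : (algebraMap ℝ (Matrix (Fin N) (Fin N) ℝ) G.lambdaMax - G.laplacian).PosSemidef := by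
    rw [Matrix.posSemidef_iff_isHermitian_and_spectrum_nonneg]
    refine ⟨?_, ?_⟩
    · refine Matrix.IsHermitian.sub ?_ G.laplacian_isHermitian
      rw [Matrix.algebraMap_eq_diagonal]
      exact Matrix.isHermitian_diagonal _
    · rw [← spectrum.singleton_sub_eq]
      rintro _ ⟨_, rfl, r, hr, rfl⟩
      -- Finiteness of the spectrum makes the supremum defining `lambdaMax` a genuine upper bound.
      have hbdd : BddAbove (spectrum ℝ G.laplacian) := by
        rw [G.laplacian_isHermitian.spectrum_real_eq_range_eigenvalues]
        exact (Set.finite_range _).bddAbove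
      exact sub_nonneg.2 (le_csSup hbdd hr)
  have h := hpsd.dotProduct_mulVec_nonneg v
  rw [Matrix.sub_mulVec, dotProduct_sub, Algebra.algebraMap_eq_smul_one, Matrix.smul_mulVec,
    Matrix.one_mulVec, dotProduct_smul, star_trivial, smul_eq_mul] at h
  linarith

theorem CommGraph.lambdaMax_nonneg [Nonempty (Fin N)] : 0 ≤ G.lambdaMax := by
  have h := G.dotProduct_laplacian_le (fun _ => 1)
  have h0 : G.laplacian.mulVec (fun _ => 1) = 0 := by
    ext i
    simp [G.laplacian_mulVec_apply]
  rw [h0, dotProduct_zero] at h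
  have h1 : (fun _ : Fin N => (1 : ℝ)) ⬝ᵥ (fun _ => 1) = N := by simp [dotProduct]
  rw [h1] at h
  have hN : (0 : ℝ) < N := by
    have := Fin.pos_iff_nonempty.2 (inferInstance : Nonempty (Fin N))
    exact_mod_cast this
  exact nonneg_of_mul_nonneg_left h hN

/-- The stacked outputs of `N` agents with outputs in `W`. -/
abbrev Stack (N : ℕ) (W : Type*) : Type _ := PiLp 2 (fun _ : Fin N => W)

variable {W : Type*} [NormedAddCommGroup W] [InnerProductSpace ℝ W]

/-- The Laplacian acting on stacked outputs, i.e. `L ⊗ I`. -/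
def CommGraph.laplacianOp (W : Type*) [NormedAddCommGroup W] [InnerProductSpace ℝ W] :
    Stack N W →ₗ[ℝ] Stack N W where
  toFun z := WithLp.toLp 2 fun i => ∑ j, G.a i j • (z i - z j)
  map_add' x y := by
    ext i : 1
    simp only [PiLp.add_apply, ← Finset.sum_add_distrib, ← smul_add]
    exact Finset.sum_congr rfl fun j _ => by congr 1; abel
  map_smul' c x := by
    ext i : 1
    simp only [PiLp.smul_apply, RingHom.id_apply, Finset.smul_sum]
    exact Finset.sum_congr rfl fun j _ => by rw [← smul_sub, smul_comm]

theorem CommGraph.laplacianOp_apply (z : Stack N W) (i : Fin N) :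
    G.laplacianOp W z i = ∑ j, G.a i j • (z i - z j) := rfl

theorem CommGraph.inner_laplacianOp (x y : Stack N W) :
    inner ℝ (G.laplacianOp W x) y
      = 1 / 2 * ∑ i, ∑ j, G.a i j * inner ℝ (x i - x j) (y i - y j) := by
  have h1 : inner ℝ (G.laplacianOp W x) y = ∑ i, ∑ j, G.a i j * inner ℝ (x i - x j) (y i) := by
    rw [PiLp.inner_apply]
    simp only [G.laplacianOp_apply, sum_inner, real_inner_smul_left]
  have h2 : ∑ i, ∑ j, G.a i j * inner ℝ (x i - x j) (y i)
      = -∑ i, ∑ j, G.a i j * inner ℝ (x i - x j) (y j) := by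
    rw [Finset.sum_comm, ← Finset.sum_neg_distrib]
    refine Finset.sum_congr rfl fun i _ => ?_
    rw [← Finset.sum_neg_distrib]
    refine Finset.sum_congr rfl fun j _ => ?_
    rw [G.symm j i, ← neg_sub (x i) (x j), inner_neg_left]
    ring
  have h3 : ∑ i, ∑ j, G.a i j * inner ℝ (x i - x j) (y i - y j)
      = ∑ i, ∑ j, G.a i j * inner ℝ (x i - x j) (y i)
        - ∑ i, ∑ j, G.a i j * inner ℝ (x i - x j) (y j) := by
    simp only [inner_sub_right, mul_sub, Finset.sum_sub_distrib]
  rw [h1, h3]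
  linarith

theorem CommGraph.laplacianOp_isSymmetric : (G.laplacianOp W).IsSymmetric := by
  intro x y
  rw [real_inner_comm (G.laplacianOp W y) x, G.inner_laplacianOp, G.inner_laplacianOp]
  simp only [real_inner_comm]

theorem CommGraph.inner_laplacianOp_self_nonneg (x : Stack N W) :
    0 ≤ inner ℝ (G.laplacianOp W x) x := by
  rw [G.inner_laplacianOp]
  refine mul_nonneg (by norm_num) (Finset.sum_nonneg fun i _ => Finset.sum_nonneg fun j _ => ?_)
  exact mul_nonneg (G.a_nonneg i j) real_inner_self_nonneg

/-- `L ⊗ I` acts separately on each of the `q` output coordinates, so the scalar Rayleigh bound sums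
up. -/
theorem CommGraph.inner_laplacianOp_self_le {q : ℕ} (x : Stack N (EuclideanSpace ℝ (Fin q))) :
    inner ℝ (G.laplacianOp _ x) x ≤ G.lambdaMax * ‖x‖ ^ 2 := by
  have h1 : inner ℝ (G.laplacianOp _ x) x
      = ∑ k, (fun i => x i k) ⬝ᵥ (G.laplacian.mulVec fun i => x i k) := by
    simp only [dotProduct, G.laplacian_mulVec_apply]
    rw [PiLp.inner_apply, Finset.sum_comm]
    refine Finset.sum_congr rfl fun i _ => ?_
    rw [PiLp.inner_apply]
    refine Finset.sum_congr rfl fun k _ => ?_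
    simp [G.laplacianOp_apply]
  have h2 : ‖x‖ ^ 2 = ∑ k, (fun i => x i k) ⬝ᵥ (fun i => x i k) := by
    simp only [dotProduct]
    rw [← real_inner_self_eq_norm_sq, PiLp.inner_apply, Finset.sum_comm]
    refine Finset.sum_congr rfl fun i _ => ?_
    rw [PiLp.inner_apply]
    simp [sq]
  rw [h1, h2, Finset.mul_sum]
  exact Finset.sum_le_sum fun k _ => G.dotProduct_laplacian_le _

/-- A vanishing energy forces equality across every edge, and walks propagate it. -/
theorem CommGraph.eq_of_mem_ker_laplacianOp (hG : G.graph.Connected) {x : Stack N W}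
    (hx : x ∈ LinearMap.ker (G.laplacianOp W)) (i j : Fin N) : x i = x j := by
  have h0 : inner ℝ (G.laplacianOp W x) x = 0 := by
    rw [LinearMap.mem_ker.1 hx, inner_zero_left]
  rw [G.inner_laplacianOp] at h0
  have hnn : ∀ i j, 0 ≤ G.a i j * inner ℝ (x i - x j) (x i - x j) := fun i j =>
    mul_nonneg (G.a_nonneg i j) real_inner_self_nonneg
  have h1 : ∑ i, ∑ j, G.a i j * inner ℝ (x i - x j) (x i - x j) = 0 := by linarith
  have hadj : ∀ i j, G.graph.Adj i j → x i = x j := by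
    intro i j hij
    have h2 := (Finset.sum_eq_zero_iff_of_nonneg
      (fun i _ => Finset.sum_nonneg fun j _ => hnn i j)).1 h1 i (Finset.mem_univ _)
    have h3 := (Finset.sum_eq_zero_iff_of_nonneg (fun j _ => hnn i j)).1 h2 j (Finset.mem_univ _)
    have h4 := (mul_eq_zero.1 h3).resolve_left (G.pos_of_adj i j hij).ne'
    exact sub_eq_zero.1 (inner_self_eq_zero.1 h4)
  obtain ⟨p⟩ := hG.preconnected i j
  induction p with
  | nil => rfl
  | cons h _ ih => exact (hadj _ _ h).trans ih

end Laplacian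

/-! ### Zeros of strongly monotone maps and strict minimizers. -/

section StrongMonotonicity

variable {W : Type*} [NormedAddCommGroup W] [InnerProductSpace ℝ W]

/-- A strongly monotone Lipschitz map on a Hilbert space has a zero. -/
theorem exists_zero_of_stronglyMonotone [CompleteSpace W] {g : W → W} {m w : ℝ} (hm : 0 < m)
    (hmono : ∀ x y, m * ‖x - y‖ ^ 2 ≤ inner ℝ (x - y) (g x - g y))
    (hlip : ∀ x y, ‖g x - g y‖ ≤ w * ‖x - y‖) : ∃ x, g x = 0 := by
  obtain ⟨s, hs, r, hr0, hr1, hsr⟩ : ∃ s : ℝ, 0 < s ∧ ∃ r : ℝ, 0 ≤ r ∧ r < 1 ∧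
      1 - 2 * s * m + s ^ 2 * w ^ 2 ≤ r ^ 2 := by
    have hD : 0 < m ^ 2 + w ^ 2 := by positivity
    have hlt : 1 - m ^ 2 / (m ^ 2 + w ^ 2) < 1 := by
      have : 0 < m ^ 2 / (m ^ 2 + w ^ 2) := by positivity
      linarith
    have hnn : 0 ≤ 1 - m ^ 2 / (m ^ 2 + w ^ 2) := by
      rw [sub_nonneg, div_le_one hD]
      nlinarith [sq_nonneg w]
    -- The step `s` makes `x ↦ x - s • g x` a contraction with constant `r`. The denominator `m ^ 2
    -- + w ^ 2`, instead of the usual `w ^ 2`, is positive whatever `w` is.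
    refine ⟨m / (m ^ 2 + w ^ 2), by positivity, √(1 - m ^ 2 / (m ^ 2 + w ^ 2)),
      Real.sqrt_nonneg _, ?_, ?_⟩
    · exact (Real.sqrt_lt' one_pos).2 (by simpa using hlt)
    · rw [Real.sq_sqrt hnn]
      have h1 : (m / (m ^ 2 + w ^ 2)) ^ 2 * w ^ 2 ≤ m ^ 2 / (m ^ 2 + w ^ 2) := by
        rw [div_pow, div_mul_eq_mul_div, div_le_div_iff₀ (by positivity) hD]
        nlinarith [sq_nonneg (m ^ 2), mul_nonneg (sq_nonneg m) hD.le, sq_nonneg (m * m),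
          mul_nonneg (mul_nonneg (sq_nonneg m) hD.le) (sq_nonneg m)]
      have h2 : 2 * (m / (m ^ 2 + w ^ 2)) * m = 2 * (m ^ 2 / (m ^ 2 + w ^ 2)) := by ring
      linarith
  have hT : ContractingWith ⟨r, hr0⟩ (fun x => x - s • g x) := by
    refine ⟨by exact_mod_cast hr1, LipschitzWith.of_dist_le_mul fun x y => ?_⟩
    rw [dist_eq_norm, dist_eq_norm]
    change _ ≤ r * ‖x - y‖
    have h1 : x - s • g x - (y - s • g y) = (x - y) - s • (g x - g y) := by
      rw [smul_sub]; abel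
    refine abs_le_of_sq_le_sq' ?_ (by positivity) |>.2
    rw [h1, norm_sub_sq_real, real_inner_smul_right, norm_smul, Real.norm_of_nonneg hs.le]
    have h2 := mul_le_mul_of_nonneg_left (hmono x y) hs.le
    have h3 : ‖g x - g y‖ ^ 2 ≤ w ^ 2 * ‖x - y‖ ^ 2 := by
      rw [← mul_pow]
      exact pow_le_pow_left₀ (norm_nonneg _) (hlip x y) 2
    have h4 := mul_le_mul_of_nonneg_left h3 (sq_nonneg s)
    have h5 := mul_le_mul_of_nonneg_right hsr (sq_nonneg ‖x - y‖)
    nlinarith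
  refine ⟨ContractingWith.fixedPoint _ hT, ?_⟩
  have h := hT.fixedPoint_isFixedPt
  have h1 : s • g (ContractingWith.fixedPoint _ hT) = 0 := sub_eq_self.1 h
  exact (smul_eq_zero.1 h1).resolve_left hs.ne'

/-- A zero of a strongly monotone gradient is a strict global minimizer. -/
theorem lt_of_gradient_eq_zero [CompleteSpace W] {F : W → ℝ} {g : W → W} {m : ℝ} (hm : 0 < m)
    (hF : ∀ x, HasGradientAt F (g x) x)
    (hmono : ∀ x y, m * ‖x - y‖ ^ 2 ≤ inner ℝ (x - y) (g x - g y)) {x y : W} (hx : g x = 0)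
    (hxy : y ≠ x) : F x < F y := by
  have hline : ∀ t : ℝ, HasDerivAt (fun t : ℝ => F (x + t • (y - x)))
      (inner ℝ (g (x + t • (y - x))) (y - x)) t := by
    intro t
    have h1 : HasDerivAt (fun t : ℝ => x + t • (y - x)) (y - x) t := by
      simpa using ((hasDerivAt_id t).smul_const (y - x)).const_add x
    exact (hF (x + t • (y - x))).hasFDerivAt.comp_hasDerivAt t h1
  -- Comparing the gradient with its zero at `x` gives a positive slope along the segment for `t >
  -- 0`.
  have hmonoOn : StrictMonoOn (fun t : ℝ => F (x + t • (y - x))) (Icc 0 1) := by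
    refine strictMonoOn_of_deriv_pos (convex_Icc 0 1)
      (fun t _ => (hline t).continuousAt.continuousWithinAt) fun t ht => ?_
    rw [interior_Icc] at ht
    rw [(hline t).deriv]
    have h1 := hmono (x + t • (y - x)) x
    rw [hx, sub_zero, add_sub_cancel_left, real_inner_smul_left, norm_smul, mul_pow,
      real_inner_comm] at h1
    have h2 : 0 < ‖y - x‖ := norm_pos_iff.2 (sub_ne_zero.2 hxy)
    have h3 : 0 < m * (‖t‖ ^ 2 * ‖y - x‖ ^ 2) := by
      have : 0 < ‖t‖ := norm_pos_iff.2 ht.1.ne'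
      positivity
    exact pos_of_mul_pos_right (h3.trans_le h1) ht.1.le
  simpa using hmonoOn (left_mem_Icc.2 zero_le_one) (right_mem_Icc.2 zero_le_one) zero_lt_one

end StrongMonotonicity

/-! ### Invariance of the complement of the kernel. -/

section Orthogonality

variable {E : Type*} [NormedAddCommGroup E] [InnerProductSpace ℝ E]

/-- A curve whose velocity lies in the range of a symmetric operator stays orthogonal to the
kernel of that operator. -/
theorem mem_orthogonal_ker_of_deriv_right {L : E →ₗ[ℝ] E} (hL : L.IsSymmetric) {ζ : ℝ → E}
    (hζ : ContinuousOn ζ (Ici 0)) (h0 : ζ 0 ∈ (LinearMap.ker L)ᗮ)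
    (hd : ∀ t, 0 ≤ t → ∃ v, HasDerivWithinAt ζ (L v) (Ici t) t) (t : ℝ) (ht : 0 ≤ t) :
    ζ t ∈ (LinearMap.ker L)ᗮ := by
  intro v hv
  refine (constant_of_has_deriv_right_zero (f := fun s => inner ℝ v (ζ s)) (a := 0) (b := t)
    (continuousOn_const.inner (hζ.mono Icc_subset_Ici_self)) (fun s hs => ?_) t
    (right_mem_Icc.2 ht)).trans (h0 v hv)
  obtain ⟨p, hp⟩ := hd s hs.1
  have h1 := (hasDerivWithinAt_const s (Ici s) v).inner ℝ hp
  rwa [← hL, LinearMap.mem_ker.1 hv, inner_zero_left, inner_zero_left, add_zero] at h1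

end Orthogonality

/-! ### From individual agents to the stacked error system. -/

section StackedErrors

variable {N : ℕ} {W : Type*} [NormedAddCommGroup W]

/-- The stacked map `g`, recentred at the consensus value `v`. -/
def stackShift (g : Fin N → W → W) (v : W) (z : Stack N W) : Stack N W :=
  WithLp.toLp 2 fun i => g i (v + z i) - g i v

theorem continuous_stackShift {g : Fin N → W → W} (hg : ∀ i, Continuous (g i)) (v : W) :
    Continuous (stackShift g v) := by
  refine (PiLp.continuous_toLp 2 _).comp (continuous_pi fun i => ?_)
  exact ((hg i).comp (by fun_prop)).sub continuous_const

theorem norm_stackShift_le {g : Fin N → W → W} {w : ℝ} (hw : 0 ≤ w)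
    (hg : ∀ i x y, ‖g i x - g i y‖ ≤ w * ‖x - y‖) (v : W) (z : Stack N W) :
    ‖stackShift g v z‖ ≤ w * ‖z‖ := by
  refine abs_le_of_sq_le_sq' ?_ (by positivity) |>.2
  rw [mul_pow, PiLp.norm_sq_eq_of_L2, PiLp.norm_sq_eq_of_L2, Finset.mul_sum]
  refine Finset.sum_le_sum fun i _ => ?_
  rw [← mul_pow]
  refine pow_le_pow_left₀ (norm_nonneg _) ?_ 2
  simpa [stackShift] using hg i (v + z i) v

theorem continuousOn_stack {f : Fin N → ℝ → W} {s : Set ℝ}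
    (hf : ∀ i, ContinuousOn (f i) s) :
    ContinuousOn (fun r => (WithLp.toLp 2 fun i => f i r : Stack N W)) s :=
  (PiLp.continuous_toLp 2 _).comp_continuousOn (continuousOn_pi.2 hf)

variable [InnerProductSpace ℝ W]

theorem le_inner_stackShift {g : Fin N → W → W} {m : ℝ}
    (hg : ∀ i x y, m * ‖x - y‖ ^ 2 ≤ inner ℝ (x - y) (g i x - g i y)) (v : W) (z : Stack N W) :
    m * ‖z‖ ^ 2 ≤ inner ℝ z (stackShift g v z) := by
  rw [PiLp.norm_sq_eq_of_L2, PiLp.inner_apply, Finset.mul_sum]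
  refine Finset.sum_le_sum fun i _ => ?_
  simpa [stackShift] using hg i (v + z i) v

theorem hasDerivWithinAt_stack {f : Fin N → ℝ → W} {f' : Stack N W}
    {s : Set ℝ} {t : ℝ} (hf : ∀ i, HasDerivWithinAt (f i) (f' i) s t) :
    HasDerivWithinAt (fun r => (WithLp.toLp 2 fun i => f i r : Stack N W)) f' s t := by
  have h1 : HasDerivWithinAt (fun r i => f i r) (fun i => f' i) s t := hasDerivWithinAt_pi.2 hf
  exact ((PiLp.continuousLinearEquiv 2 ℝ fun _ : Fin N => W).symm :
    _ →L[ℝ] Stack N W).hasFDerivAt.comp_hasDerivWithinAt t h1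

/-- The stacked errors of the linearized closed loop solve the sampled error system. -/
theorem isSampledSolution_stack [FiniteDimensional ℝ W] {G : CommGraph N}
    (hG : G.graph.Connected) {g : Fin N → W → W} {v : W} (hv : ∑ i, g i v = 0) {Δ : ℝ}
    (hΔ : 0 < Δ) {y η : Fin N → ℝ → W} (hyc : ∀ i, ContinuousOn (y i) (Ici 0))
    (hηc : ∀ i, ContinuousOn (η i) (Ici 0)) (hη0 : ∀ i, η i 0 = 0)
    (hy : ∀ k : ℕ, ∀ t ∈ Ico (k * Δ) ((k + 1) * Δ), ∀ i, HasDerivWithinAt (y i)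
      (-g i (y i t) - ∑ j, G.a i j • (y i (k * Δ) - y j (k * Δ)) - η i t) (Ici t) t)
    (hη : ∀ k : ℕ, ∀ t ∈ Ico (k * Δ) ((k + 1) * Δ), ∀ i, HasDerivWithinAt (η i)
      (∑ j, G.a i j • (y i (k * Δ) - y j (k * Δ))) (Ici t) t) :
    IsSampledSolution (G.laplacianOp W) (stackShift g v) Δ
      (fun t => WithLp.toLp 2 fun i => y i t - v)
      (fun t => WithLp.toLp 2 fun i => η i t + g i v) := by
  set z : ℝ → Stack N W := fun t => WithLp.toLp 2 fun i => y i t - v with hz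
  set ζ : ℝ → Stack N W := fun t => WithLp.toLp 2 fun i => η i t + g i v with hζ
  have hζc : ContinuousOn ζ (Ici 0) :=
    continuousOn_stack fun i => (hηc i).add continuousOn_const
  have hlap : ∀ (s : ℝ) i, ∑ j, G.a i j • (y i s - y j s) = G.laplacianOp W (z s) i := by
    intro s i
    rw [G.laplacianOp_apply]
    exact Finset.sum_congr rfl fun j _ => by simp [hz]
  have hζd : ∀ k : ℕ, ∀ t ∈ Ico (k * Δ) ((k + 1) * Δ),
      HasDerivWithinAt ζ (G.laplacianOp W (z (k * Δ))) (Ici t) t := by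
    intro k t ht
    refine hasDerivWithinAt_stack fun i => ?_
    rw [← hlap]
    exact (hη k t ht i).add_const _
  refine ⟨continuousOn_stack fun i => (hyc i).sub continuousOn_const, hζc, fun k t ht => ?_, hζd,
    fun t ht => ?_⟩
  · refine hasDerivWithinAt_stack fun i => ?_
    refine ((hy k t ht i).sub_const v).congr_deriv ?_
    rw [hlap]
    simp only [PiLp.sub_apply, PiLp.neg_apply, stackShift, hz, hζ, add_sub_cancel]
    abel
  · refine mem_orthogonal_ker_of_deriv_right G.laplacianOp_isSymmetric hζc (fun x hx => ?_)
      (fun s hs => ?_) t ht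
    · obtain ⟨i₀⟩ := hG.nonempty
      rw [PiLp.inner_apply]
      -- Kernel vectors are consensus vectors and `η` starts at zero, so the pairing with `ζ 0`
      -- collapses to one with `∑ i, g i v = 0`.
      have h1 : ∀ i, inner ℝ (x i) (ζ 0 i) = inner ℝ (x i₀) (g i v) := by
        intro i
        rw [G.eq_of_mem_ker_laplacianOp hG hx i i₀]
        simp [hζ, hη0 i]
      rw [Finset.sum_congr rfl fun i _ => h1 i, ← inner_sum, hv, inner_zero_right]
    · obtain ⟨k, hk⟩ := exists_mem_Ico_mul hΔ hs
      exact ⟨_, hζd k s hk⟩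

end StackedErrors

/-! ### Uniform cost constants, the optimum and the linearized outputs. -/

section ClosedLoop

variable {N q : ℕ} {S : MultiAgent N q} {G : CommGraph N} {w m : Fin N → ℝ}

theorem MultiAgent.SmoothCosts.lipschitz_iSup (hw : S.SmoothCosts w) (i : Fin N)
    (x y : EuclideanSpace ℝ (Fin q)) :
    ‖gradient (S.f i) x - gradient (S.f i) y‖ ≤ (⨆ i, w i) * ‖x - y‖ :=
  (hw.lipschitz i x y).trans
    (mul_le_mul_of_nonneg_right (le_ciSup (finite_range w).bddAbove i) (norm_nonneg _))

theorem MultiAgent.SmoothCosts.continuous_gradient (hw : S.SmoothCosts w) (i : Fin N) :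
    Continuous (gradient (S.f i)) := by
  refine (LipschitzWith.of_dist_le_mul (K := ⟨w i, (hw.pos i).le⟩) fun x y => ?_).continuous
  rw [dist_eq_norm, dist_eq_norm]
  exact hw.lipschitz i x y

theorem MultiAgent.StronglyConvexCosts.iInf_pos [Nonempty (Fin N)]
    (hm : S.StronglyConvexCosts m) : 0 < ⨅ i, m i := by
  obtain ⟨i, hi⟩ := exists_eq_ciInf_of_finite (f := m)
  rw [← hi]
  exact hm.pos i

theorem MultiAgent.StronglyConvexCosts.strong_iInf (hm : S.StronglyConvexCosts m) (i : Fin N)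
    (x y : EuclideanSpace ℝ (Fin q)) :
    (⨅ i, m i) * ‖x - y‖ ^ 2 ≤ inner ℝ (x - y) (gradient (S.f i) x - gradient (S.f i) y) :=
  (mul_le_mul_of_nonneg_right (ciInf_le (finite_range m).bddBelow i) (sq_nonneg _)).trans
    (hm.strong i x y)

/-- Cauchy–Schwarz between strong monotonicity and the Lipschitz bound at one nonzero point; without
such a point the comparison can fail. -/
theorem iInf_le_iSup_of_costs [Nonempty (Fin N)] [Nontrivial (EuclideanSpace ℝ (Fin q))]
    (hw : S.SmoothCosts w) (hm : S.StronglyConvexCosts m) : ⨅ i, m i ≤ ⨆ i, w i := by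
  obtain ⟨x, hx⟩ := exists_ne (0 : EuclideanSpace ℝ (Fin q))
  obtain ⟨i⟩ := (inferInstance : Nonempty (Fin N))
  have h1 := hm.strong_iInf i x 0
  have h2 := hw.lipschitz_iSup i x 0
  have h3 := real_inner_le_norm (x - 0) (gradient (S.f i) x - gradient (S.f i) 0)
  have h4 : 0 < ‖x - 0‖ := by simpa using hx
  have h5 := mul_le_mul_of_nonneg_left h2 h4.le
  have h6 : (⨅ i, m i) * ‖x - 0‖ ^ 2 ≤ (⨆ i, w i) * ‖x - 0‖ ^ 2 := by linarith
  exact le_of_mul_le_mul_right h6 (by positivity)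

/-- The optimization problem has a unique solution, where the local gradients sum to zero. -/
theorem MultiAgent.exists_unique_isOptimal [Nonempty (Fin N)] (hw : S.SmoothCosts w)
    (hm : S.StronglyConvexCosts m) :
    ∃ ystar, S.IsOptimal ystar ∧ (∀ z, S.IsOptimal z → z = ystar) ∧
      ∑ i, gradient (S.f i) ystar = 0 := by
  set g : EuclideanSpace ℝ (Fin q) → EuclideanSpace ℝ (Fin q) :=
    fun x => ∑ i, gradient (S.f i) x with hg
  have hmpos : 0 < ∑ i, m i := Finset.sum_pos (fun i _ => hm.pos i) Finset.univ_nonempty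
  have hmono : ∀ x y, (∑ i, m i) * ‖x - y‖ ^ 2 ≤ inner ℝ (x - y) (g x - g y) := by
    intro x y
    rw [hg, ← Finset.sum_sub_distrib, inner_sum, Finset.sum_mul]
    exact Finset.sum_le_sum fun i _ => hm.strong i x y
  have hlip : ∀ x y, ‖g x - g y‖ ≤ (∑ i, w i) * ‖x - y‖ := by
    intro x y
    rw [hg, ← Finset.sum_sub_distrib, Finset.sum_mul]
    exact (norm_sum_le _ _).trans (Finset.sum_le_sum fun i _ => hw.lipschitz i x y)
  have hF : ∀ x, HasGradientAt (fun x => ∑ i, S.f i x) (g x) x := by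
    intro x
    rw [hasGradientAt_iff_hasFDerivAt, hg, map_sum]
    exact HasFDerivAt.fun_sum fun i _ => ((hw.differentiable i) x).hasGradientAt.hasFDerivAt
  obtain ⟨ystar, hy⟩ := exists_zero_of_stronglyMonotone hmpos hmono hlip
  have hlt : ∀ z, z ≠ ystar → ∑ i, S.f i ystar < ∑ i, S.f i z := fun z hz =>
    lt_of_gradient_eq_zero hmpos hF hmono hy hz
  refine ⟨ystar, ?_, fun z hz => ?_, hy⟩
  · intro y hyc
    obtain ⟨i₀⟩ := (inferInstance : Nonempty (Fin N))
    have h1 : y = fun _ => y i₀ := funext fun i => hyc i i₀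
    change ∑ i, S.f i ystar ≤ ∑ i, S.f i (y i)
    rw [h1]
    by_cases h2 : y i₀ = ystar
    · rw [h2]
    · exact (hlt _ h2).le
  · by_contra hne
    have h1 : ∑ i, S.f i z ≤ ∑ i, S.f i ystar :=
      hz (a := fun _ => ystar) (fun _ _ => rfl)
    exact absurd h1 (not_le.2 (hlt z hne))

theorem toEuclideanLin_mul_apply {a b c : ℕ} (A : Matrix (Fin a) (Fin b) ℝ)
    (B : Matrix (Fin b) (Fin c) ℝ) (x : EuclideanSpace ℝ (Fin c)) :
    Matrix.toEuclideanLin (A * B) x = Matrix.toEuclideanLin A (Matrix.toEuclideanLin B x) := by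
  simp [Matrix.toLpLin_apply, Matrix.mulVec_mulVec]

variable {Kα : ∀ i, Matrix (Fin (S.p i)) (Fin (S.n i)) ℝ}
  {Kβ : ∀ i, Matrix (Fin (S.p i)) (Fin q) ℝ} {tk : Fin N → ℕ → ℝ}
  {x : ∀ i, ℝ → EuclideanSpace ℝ (Fin (S.n i))} {u : ∀ i, ℝ → EuclideanSpace ℝ (Fin (S.p i))}
  {y yhat η : Fin N → ℝ → EuclideanSpace ℝ (Fin q)}

/-- The feedback linearizes the output dynamics. -/
theorem MultiAgent.IsTrajectory.output_deriv (h : S.IsTrajectory G Kα Kβ tk x u y yhat η)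
    (hKα : ∀ i, S.C i * S.B i * Kα i = S.C i * S.A i)
    (hKβ : ∀ i, S.C i * S.B i * Kβ i = 1) (i : Fin N) {t : ℝ} (ht : 0 ≤ t) :
    HasDerivWithinAt (y i)
      (-gradient (S.f i) (y i t) - ∑ j, G.a i j • (yhat i t - yhat j t) - η i t) (Ici t) t := by
  set r := -gradient (S.f i) (y i t) - ∑ j, G.a i j • (yhat i t - yhat j t) - η i t with hr
  have h1 := (Matrix.toEuclideanLin (S.C i)).toContinuousLinearMap.hasFDerivAt
    |>.comp_hasDerivWithinAt t (h.state_deriv i t ht)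
  have h2 : Matrix.toEuclideanLin (S.C i) (Matrix.toEuclideanLin (S.A i) (x i t)
      + Matrix.toEuclideanLin (S.B i) (u i t)) = r := by
    rw [h.input i t ht, ← hr]
    simp only [map_add, map_neg, ← toEuclideanLin_mul_apply, ← Matrix.mul_assoc, hKα i, hKβ i]
    simp [Matrix.toLpLin_apply]
  change HasDerivWithinAt _ (Matrix.toEuclideanLin (S.C i) _) _ _ at h1
  rw [h2] at h1
  exact h1.congr (fun s hs => h.output i s (ht.trans hs)) (h.output i t ht)

theorem MultiAgent.IsTrajectory.output_continuousOn
    (h : S.IsTrajectory G Kα Kβ tk x u y yhat η) (i : Fin N) : ContinuousOn (y i) (Ici 0) :=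
  ((Matrix.toEuclideanLin (S.C i)).continuous_of_finiteDimensional.comp_continuousOn
    (h.state_continuous i)).congr fun t ht => h.output i t ht

end ClosedLoop

end OptimalOutput

end

/-! ### The main theorem. -/

theorem theorem2 {N q : ℕ} (S : OptimalOutput.MultiAgent N q) (G : OptimalOutput.CommGraph N)
    (w m : Fin N → ℝ)
    (hG : G.graph.Connected)
    (hw : S.SmoothCosts w)
    (hm : S.StronglyConvexCosts m)
    (hrank : S.RankCondition)
    (Kα : ∀ i, Matrix (Fin (S.p i)) (Fin (S.n i)) ℝ)
    (Kβ : ∀ i, Matrix (Fin (S.p i)) (Fin q) ℝ)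
    (hKα : ∀ i, S.C i * S.B i * Kα i = S.C i * S.A i)
    (hKβ : ∀ i, S.C i * S.B i * Kβ i = 1)
    (ξ : ℝ)
    (hξ : (4 * (⨆ i, w i) ^ 2 + 2 * G.lambdaMax ^ 2 + 1) / (8 * ⨅ i, m i) < ξ) :
    ∃ ystar : EuclideanSpace ℝ (Fin q),
      S.IsOptimal ystar ∧ (∀ z, S.IsOptimal z → z = ystar) ∧
      ∃ c : ℝ, 0 < c ∧
        ∀ Δ ∈ Set.Ioc 0 (OptimalOutput.tau0 (⨆ i, w i) G.lambdaMax ξ),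
        ∀ tk : Fin N → ℕ → ℝ, (∀ i, tk i 0 = 0) → (∀ i k, tk i (k + 1) = tk i k + Δ) →
        ∀ x u y yhat η, S.IsTrajectory G Kα Kβ tk x u y yhat η →
          ∃ M : ℝ, ∀ i, ∀ t, 0 ≤ t → ‖y i t - ystar‖ ≤ M * Real.exp (-c * t) := by
  have : Nonempty (Fin N) := hG.nonempty
  obtain ⟨ystar, hopt, huniq, hgrad⟩ := OptimalOutput.MultiAgent.exists_unique_isOptimal hw hm
  refine ⟨ystar, hopt, huniq, ?_⟩
  -- For `q = 0` the comparison of `m` with `w` is unavailable, but all outputs coincide.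
  rcases subsingleton_or_nontrivial (EuclideanSpace ℝ (Fin q)) with hsub | hnt
  · exact ⟨1, one_pos, fun _ _ _ _ _ _ _ y _ _ _ => ⟨0, fun i t _ => by
      rw [Subsingleton.elim (y i t - ystar) 0]
      simp⟩⟩
  have hm0 := hm.iInf_pos
  have hξ' : 4 * (⨆ i, w i) ^ 2 + 2 * G.lambdaMax ^ 2 + 1 < 8 * (⨅ i, m i) * ξ := by
    rw [div_lt_iff₀ (by positivity)] at hξ
    linarith
  have hw0 : 0 ≤ ⨆ i, w i := Real.iSup_nonneg fun i => (hw.pos i).le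
  obtain ⟨c, hc, hdecay⟩ := OptimalOutput.exists_rate_of_isSampledSolution
    (L := G.laplacianOp (EuclideanSpace ℝ (Fin q))) G.laplacianOp_isSymmetric
    G.inner_laplacianOp_self_nonneg G.lambdaMax_nonneg G.inner_laplacianOp_self_le hm0
    (OptimalOutput.iInf_le_iSup_of_costs hw hm) hξ'
    (OptimalOutput.continuous_stackShift hw.continuous_gradient ystar)
    (OptimalOutput.le_inner_stackShift hm.strong_iInf ystar)
    (OptimalOutput.norm_stackShift_le hw0 hw.lipschitz_iSup ystar)
  refine ⟨c, hc, fun Δ hΔ tk htk0 htks x u y yhat η htraj => ?_⟩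
  have htk : ∀ i k, tk i k = k * Δ := by
    intro i k
    induction k with
    | zero => simp [htk0]
    | succ k ih =>
      rw [htks, ih]
      push_cast
      ring
  have hhat : ∀ k : ℕ, ∀ t ∈ Set.Ico (k * Δ) ((k + 1) * Δ), ∀ i, yhat i t = y i (k * Δ) := by
    intro k t ht i
    rw [htraj.hold i k t (by rw [htk, htk]; exact_mod_cast ht), htk]
  have hnn : ∀ k : ℕ, ∀ t ∈ Set.Ico (k * Δ) ((k + 1) * Δ), 0 ≤ t := fun k t ht =>
    (mul_nonneg k.cast_nonneg hΔ.1.le).trans ht.1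
  obtain ⟨M, hM⟩ := hdecay Δ hΔ _ _ (OptimalOutput.isSampledSolution_stack hG hgrad hΔ.1
    htraj.output_continuousOn htraj.integral_continuous htraj.integral_zero
    (fun k t ht i => by
      simpa only [hhat k t ht] using htraj.output_deriv hKα hKβ i (hnn k t ht))
    (fun k t ht i => by
      simpa only [hhat k t ht] using htraj.integral_deriv i t (hnn k t ht)))
  exact ⟨M, fun i t ht => (PiLp.norm_apply_le (WithLp.toLp 2 fun i => y i t - ystar :
    OptimalOutput.Stack N (EuclideanSpace ℝ (Fin q))) i).trans (hM t ht)⟩
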